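/- All Banach spaces are real; for a Banach space $X$, $S(X)$ denotes its unit sphere. For a set $\Gamma$, $a\in \ell_1(\Gamma)$ and $x\in\ell_\infty(\Gamma,X)$ (the bounded functions $\Gamma\to X$ with the supremum norm) put $a(x)=\sum_{\gamma\in\Gamma}a(\gamma)x(\gamma)\in X$. For $A\subset S(\ell_1(\Gamma))$ let $h(X,A)\in[0,\infty]$ be the supremum of those $\delta\ge 0$ for which there is $x\in S(\ell_\infty(\Gamma,X))$ with $\inf_{a\in A}\|a(x)\|\ge\delta$ (with $\sup\emptyset=0$ and $\inf\emptyset=\infty$). Let $P$ be a class of Banach spaces. We say that $(\delta,\Gamma,A)$, where $\delta>0$ is real, $\Gamma$ is a set and $A\subset S(\ell_1(\Gamma))$, *describes* $P$ if: (1) every $a\in A$ is finitely non-zero; (2) if $a_0\in A$, $a\in S(\ell_1(\Gamma))$ and $\operatorname{sign}a(\gamma)=\operatorname{sign}a_0(\gamma)$ for all $\gamma\in\Gamma$, then $a\in A$; (3) for every Banach space $X$, the conditions $X\notin P$, $h(X,A)>0$ and $h(X,A)\ge\delta$ are equivalent. The class $P$ is a *regular $l_1$-property* if some $(\delta,\Gamma,A)$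 describes it. The *coclass* $P^{\rm co}$ is the class of all Banach spaces $X$ such that $X^{**}/X$ belongs to $P$. **Theorem.** Let $P$ be a regular $l_1$-property. Then $P^{\rm co}$ is also a regular $l_1$-property. Moreover, if $(\delta,\Gamma,A)$ describes $P$ and $A\neq\emptyset$, then $(\delta/3,\Psi,E)$ describes $P^{\rm co}$; in particular, for every Banach space $X$, $$X\notin P^{\rm co}\iff h(X,E)>0\iff h(X,E)\ge\delta/3 .$$ Here $\mathbf S(A)=\{\operatorname{sign}a: a\in A\}$ is the set of sign patterns $\Gamma\to\{0,1,-1\}$ of elements of $A$, $\Psi$ is the set of all triples $(\gamma,\alpha,k)$ with $\gamma\in\Gamma$, $\alpha$ a finite subset of $\mathbf S(A)$ and $k\in\mathbb N$, and $E$ is the set of all finitely non-zero $e\in S(\ell_1(\Psi))$ for which there are a finite set $\beta\subset\mathbf S(A)$, some $\mathbf s\in\beta$ and $n\in\mathbb N$ such that every non-zero coordinate $e(\gamma,\alpha,k)$ satisfies one of the following: either $\mathbf s\in\alpha\subset\beta$, $k\le n$ and $\operatorname{sign}e(\gamma,\alpha,k)=\mathbf s(\gamma)$; or $\beta\subset\alpha$,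 $k>n$ and $\operatorname{sign}e(\gamma,\alpha,k)=-\mathbf s(\gamma)$. -/

import Mathlib

open scoped ENNReal

universe u

noncomputable section

/-- A class (property) of real Banach spaces. -/
def BanachClass : Type (u + 1) :=
  ∀ (X : Type u) [NormedAddCommGroup X] [NormedSpace ℝ X] [CompleteSpace X], Prop

/-- The real Banach space `l₁(Γ)`. -/
abbrev EllOne (Γ : Type u) : Type u := lp (fun _ : Γ => ℝ) 1

/-- The Banach space `l_∞(Γ, X)` of bounded functions `Γ → X` with the supremum norm. -/
abbrev EllInfty (Γ : Type u) (X : Type u) [NormedAddCommGroup X] : Type u :=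
  lp (fun _ : Γ => X) ∞

/-- The value `a(x) = ∑ γ, a(γ) x(γ)` at `x ∈ l_∞(Γ, X)` of the operator given by `a ∈ l₁(Γ)`.
The series converges absolutely when `X` is complete. -/
def l1Apply {Γ X : Type u} [NormedAddCommGroup X] [NormedSpace ℝ X]
    (a : EllOne Γ) (x : EllInfty Γ X) : X :=
  ∑' γ, a γ • x γ

/-- The index `h(X, A)`: the supremum of those `δ` for which some `x` in the unit sphere of
`l_∞(Γ, X)` has `inf_{a ∈ A} ‖a(x)‖ ≥ δ`. It is computed in `[0, ∞]`, so that the supremum of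
the empty set is `0` and the infimum over the empty set is `∞`. -/
def l1Index (X : Type u) [NormedAddCommGroup X] [NormedSpace ℝ X]
    {Γ : Type u} (A : Set (EllOne Γ)) : ℝ≥0∞ :=
  sSup {δ : ℝ≥0∞ | ∃ x ∈ Metric.sphere (0 : EllInfty Γ X) 1, δ ≤ ⨅ a ∈ A, ‖l1Apply a x‖ₑ}

/-- `δ > 0` and `A ⊆ S(l₁(Γ))` describe the class `P` as a regular `l₁`-property. -/
structure DescribesRegular (P : BanachClass.{u}) (δ : ℝ) {Γ : Type u}
    (A : Set (EllOne Γ)) : Prop where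
  pos : 0 < δ
  subset_sphere : A ⊆ Metric.sphere (0 : EllOne Γ) 1
  finite_support : ∀ a ∈ A, (Function.support (a : Γ → ℝ)).Finite
  sign_closed : ∀ a₀ ∈ A, ∀ a ∈ Metric.sphere (0 : EllOne Γ) 1,
    (∀ γ, SignType.sign (a₀ γ) = SignType.sign (a γ)) → a ∈ A
  notMem_iff_index_pos :
    ∀ (X : Type u) [NormedAddCommGroup X] [NormedSpace ℝ X] [CompleteSpace X],
      ¬ P X ↔ 0 < l1Index X A
  notMem_iff_le_index :
    ∀ (X : Type u) [NormedAddCommGroup X] [NormedSpace ℝ X] [CompleteSpace X],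
      ¬ P X ↔ ENNReal.ofReal δ ≤ l1Index X A

/-- Regular `l₁`-properties. -/
def IsRegularL1Property (P : BanachClass.{u}) : Prop :=
  ∃ (δ : ℝ) (Γ : Type u) (A : Set (EllOne Γ)), DescribesRegular P δ A

/-- The quotient normed space `F / j(E)` by the image of a linear isometric embedding `j`. -/
abbrev QuotientByImage {E F : Type u} [NormedAddCommGroup E] [NormedSpace ℝ E]
    [NormedAddCommGroup F] [NormedSpace ℝ F] (j : E →ₗᵢ[ℝ] F) : Type u :=
  F ⧸ LinearMap.range j.toLinearMap

/-- The image of a Banach space under a linear isometric embedding is closed, so that the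
quotient by it is a normed (and not only a seminormed) space. -/
instance isClosed_range_linearIsometry {E F : Type u} [NormedAddCommGroup E] [NormedSpace ℝ E]
    [CompleteSpace E] [NormedAddCommGroup F] [NormedSpace ℝ F] (j : E →ₗᵢ[ℝ] F) :
    IsClosed (LinearMap.range j.toLinearMap : Set F) := by
  have h : IsClosed (Set.range j) := j.isometry.isClosedEmbedding.isClosed_range
  rwa [LinearMap.coe_range]

/-- The coclass `P^co`: all Banach spaces `X` such that the Banach space `X** / X` (the quotient
of the bidual by the canonical image of `X`, with the quotient norm) belongs to `P`. -/
def coclass (P : BanachClass.{u}) : BanachClass.{u} := fun X _ _ _ =>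
  P (QuotientByImage (E := X) (F := StrongDual ℝ (StrongDual ℝ X))
    (NormedSpace.inclusionInDoubleDualLi (E := X) ℝ))

/-- The set `S(A)` of admissible signs for `A`: the sign patterns `Γ → {0, 1, -1}` of the
elements of `A`. -/
def admissibleSigns {Γ : Type u} (A : Set (EllOne Γ)) : Set (Γ → SignType) :=
  {s | ∃ a ∈ A, ∀ γ, s γ = SignType.sign (a γ)}

/-- The index set `Ψ` of all triples `(γ, α, k)` with `γ ∈ Γ`, `α` a finite set of admissible
signs for `A`, and `k` a natural number. -/
abbrev CoIndex {Γ : Type u} (A : Set (EllOne Γ)) : Type u :=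
  Γ × Finset (admissibleSigns A) × ℕ

/-- The family `E ⊆ S(l₁(Ψ))`: finitely supported norm-one vectors `e` for which there are a
finite set `β` of admissible signs, some `s ∈ β` and a number `n` such that each non-zero
coordinate `e(γ, α, k)` either has `s ∈ α ⊆ β`, `k ≤ n` and the sign `s(γ)`, or has `β ⊆ α`,
`k > n` and the sign `-s(γ)`. (In particular `s(γ) ≠ 0`.) -/
def coFamily {Γ : Type u} (A : Set (EllOne Γ)) : Set (EllOne (CoIndex A)) :=
  {e | e ∈ Metric.sphere (0 : EllOne (CoIndex A)) 1 ∧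
    (Function.support (e : CoIndex A → ℝ)).Finite ∧
    ∃ (β : Finset (admissibleSigns A)) (s : admissibleSigns A) (n : ℕ), s ∈ β ∧
      ∀ (γ : Γ) (α : Finset (admissibleSigns A)) (k : ℕ), e (γ, α, k) ≠ 0 →
        (s ∈ α ∧ α ⊆ β ∧ k ≤ n ∧ SignType.sign (e (γ, α, k)) = s.1 γ) ∨
        (β ⊆ α ∧ n < k ∧ SignType.sign (e (γ, α, k)) = - s.1 γ)}

end

/-! The index of X** / X over A is compared with that of X over E by passing between vectors of X**
/ X and families in X that approximate their lifts to X**. Given a good family z in X** / X,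
separation yields for each sign pattern s a functional f with s(γ) f(z γ) ≥ r on the support of s;
pulled back to X**, it annihilates X. Helly's theorem, used alternately for X* and X, gives
functionals g that kill the earlier vectors but keep the values of f at the lifts, and vectors x on
which the earlier g agree with the lifts (`exists_interlaced_approximation`). The functional
"initial g minus twice a later g" then takes the value f on early coordinates and -f on late ones,
which matches the signs allowed in E; its norm of about 3 is the source of δ/3
(`exists_forall_le_norm_coFamily`). Conversely, a good family in X has weak* limits v γ in X** along
an ultrafilter. If a(v) were closer than r to some y in X, Mazur's theorem would give an early and a
late convex combination both closer than r to y. Half their difference has the form e(x) with e in E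
and norm below r, a contradiction (`IsSignFamily.exists_forall_le_norm_sub`). This direction loses
no constant. -/

/-! ### Helly's theorem -/

theorem inclusionInDoubleDual_surjective_of_finiteDimensional (Z : Type*)
    [NormedAddCommGroup Z] [NormedSpace ℝ Z] [FiniteDimensional ℝ Z] :
    Function.Surjective (NormedSpace.inclusionInDoubleDualLi (E := Z) ℝ) := by
  have hd : ∀ (W : Type _) [NormedAddCommGroup W] [NormedSpace ℝ W] [FiniteDimensional ℝ W],
      Module.finrank ℝ (StrongDual ℝ W) = Module.finrank ℝ W := by
    intro W _ _ _
    rw [← (LinearMap.toContinuousLinearMap (𝕜 := ℝ) (E := W) (F' := ℝ)).finrank_eq]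
    exact Subspace.dual_finrank_eq
  have h := LinearMap.injective_iff_surjective_of_finrank_eq_finrank
    (f := (NormedSpace.inclusionInDoubleDualLi (E := Z) ℝ).toLinearMap)
    (by rw [hd, hd])
  exact h.1 (NormedSpace.inclusionInDoubleDualLi (E := Z) ℝ).injective

/-- The image of f in Z** has norm at most ‖f‖ and, as Z is reflexive, is evaluation at some w in Z;
a lift of w is the required y. -/
theorem exists_norm_lt_forall_apply_eq_of_quotient {Y Z : Type*} [NormedAddCommGroup Y]
    [NormedSpace ℝ Y] [NormedAddCommGroup Z] [NormedSpace ℝ Z] [FiniteDimensional ℝ Z]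
    (q : Y →L[ℝ] Z) (hq : ‖q‖ ≤ 1) (hlift : ∀ w c, ‖w‖ < c → ∃ y, q y = w ∧ ‖y‖ < c)
    (f : StrongDual ℝ (StrongDual ℝ Y)) {c : ℝ} (hc : ‖f‖ < c) :
    ∃ y : Y, ‖y‖ < c ∧ ∀ ψ : StrongDual ℝ Z, ψ (q y) = f (ψ.comp q) := by
  let qd : StrongDual ℝ Z →L[ℝ] StrongDual ℝ Y := (ContinuousLinearMap.compL ℝ Y Z ℝ).flip q
  have hqd : ∀ ψ, ‖qd ψ‖ ≤ 1 * ‖ψ‖ := fun ψ => by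
    calc ‖ψ.comp q‖ ≤ ‖ψ‖ * ‖q‖ := ContinuousLinearMap.opNorm_comp_le _ _
      _ ≤ ‖ψ‖ * 1 := by gcongr
      _ = 1 * ‖ψ‖ := by ring
  obtain ⟨w, hw⟩ := inclusionInDoubleDual_surjective_of_finiteDimensional Z (f.comp qd)
  have hwn : ‖w‖ ≤ ‖f‖ := by
    rw [← (NormedSpace.inclusionInDoubleDualLi (E := Z) ℝ).norm_map, hw]
    refine (ContinuousLinearMap.opNorm_comp_le _ _).trans ?_
    calc ‖f‖ * ‖qd‖ ≤ ‖f‖ * 1 := by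
          gcongr
          exact ContinuousLinearMap.opNorm_le_bound _ zero_le_one hqd
      _ = ‖f‖ := mul_one _
  obtain ⟨y, hy, hyn⟩ := hlift w c (hwn.trans_lt hc)
  refine ⟨y, hyn, fun ψ => ?_⟩
  rw [hy]
  exact congrArg (fun F => F ψ) hw

/-- Helly's theorem: on finitely many functionals, an element of the bidual is represented by
a vector of almost the same norm. -/
theorem exists_norm_lt_forall_apply_eq {Y : Type*} [NormedAddCommGroup Y] [NormedSpace ℝ Y]
    (f : StrongDual ℝ (StrongDual ℝ Y)) {c : ℝ} (hc : ‖f‖ < c) (Φ : Finset (StrongDual ℝ Y)) :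
    ∃ y : Y, ‖y‖ < c ∧ ∀ φ ∈ Φ, φ y = f φ := by
  let T : Y →L[ℝ] (Φ → ℝ) := ContinuousLinearMap.pi fun φ => φ.1
  -- Every φ in Φ factors through the quotient by the common kernel, which is finite-dimensional.
  let M : Submodule ℝ Y := LinearMap.ker T.toLinearMap
  have hM : IsClosed (M : Set Y) := T.isClosed_ker
  have : FiniteDimensional ℝ (Y ⧸ M) := T.toLinearMap.quotKerEquivRange.symm.finiteDimensional
  let q : Y →L[ℝ] Y ⧸ M := M.mkQ.mkContinuous 1 fun y => by
    simpa using Submodule.Quotient.norm_mk_le M y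
  have hq : ‖q‖ ≤ 1 := LinearMap.mkContinuous_norm_le _ zero_le_one _
  obtain ⟨y, hyn, hy⟩ := exists_norm_lt_forall_apply_eq_of_quotient q hq (fun w c hwc => by
    obtain ⟨y, hy, hyn⟩ := Submodule.Quotient.norm_mk_lt w (sub_pos.2 hwc)
    exact ⟨y, hy, by linarith⟩) f hc
  refine ⟨y, hyn, fun φ hφ => ?_⟩
  have hker : M ≤ LinearMap.ker φ.toLinearMap := fun m hm => by
    have := congrFun (LinearMap.mem_ker.1 hm) ⟨φ, hφ⟩
    simpa [T] using this
  let ψ : StrongDual ℝ (Y ⧸ M) := LinearMap.toContinuousLinearMap (M.liftQ φ.toLinearMap hker)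
  have hψ : ψ.comp q = φ := by
    ext v
    simp [ψ, q]
  rw [← hψ, ← hy ψ]
  rfl

/-! ### The index through families in the unit ball -/

theorem ofReal_le_l1Index {Γ X : Type u} [NormedAddCommGroup X] [NormedSpace ℝ X]
    {A : Set (EllOne Γ)} (hA : A.Nonempty) {r : ℝ} (hr : 0 < r) (x : Γ → X)
    (hx : ∀ γ, ‖x γ‖ ≤ 1) (h : ∀ a ∈ A, r ≤ ‖∑' γ, a γ • x γ‖) :
    ENNReal.ofReal r ≤ l1Index X A := by
  let y : EllInfty Γ X := ⟨x, memℓp_infty ⟨1, by rintro _ ⟨γ, rfl⟩; exact hx γ⟩⟩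
  have hy : ∀ γ, y γ = x γ := fun _ => rfl
  have hy1 : ‖y‖ ≤ 1 := lp.norm_le_of_forall_le zero_le_one hx
  have hy0 : y ≠ 0 := by
    intro h0
    obtain ⟨a, ha⟩ := hA
    have hz : ∀ γ, x γ = 0 := fun γ => by rw [← hy, h0]; rfl
    have := h a ha
    simp only [hz, smul_zero, tsum_zero, norm_zero] at this
    linarith
  have hpos : 0 < ‖y‖ := norm_pos_iff.2 hy0
  -- Since 0 < ‖y‖ ≤ 1, normalizing to the sphere can only increase the norms.
  refine le_sSup ⟨‖y‖⁻¹ • y, ?_, ?_⟩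
  · rw [mem_sphere_zero_iff_norm, norm_smul, norm_inv, norm_norm, inv_mul_cancel₀ hpos.ne']
  · refine le_iInf₂ fun a ha => ?_
    have he : l1Apply a (‖y‖⁻¹ • y) = ‖y‖⁻¹ • ∑' γ, a γ • x γ := by
      rw [← tsum_const_smul'']
      refine tsum_congr fun γ => ?_
      rw [lp.coeFn_smul, Pi.smul_apply, smul_comm, hy]
    rw [he, ← ofReal_norm, norm_smul, norm_inv, norm_norm]
    refine ENNReal.ofReal_le_ofReal ((h a ha).trans ?_)
    exact le_mul_of_one_le_left (norm_nonneg _) ((one_le_inv₀ hpos).2 hy1)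

theorem exists_of_lt_l1Index {Γ X : Type u} [NormedAddCommGroup X] [NormedSpace ℝ X]
    {A : Set (EllOne Γ)} {r : ℝ} (hr : ENNReal.ofReal r < l1Index X A) :
    ∃ x : Γ → X, (∀ γ, ‖x γ‖ ≤ 1) ∧ ∀ a ∈ A, r ≤ ‖∑' γ, a γ • x γ‖ := by
  obtain ⟨δ, ⟨x, hx, hδ⟩, hrδ⟩ := lt_sSup_iff.1 hr
  rw [mem_sphere_zero_iff_norm] at hx
  refine ⟨x, fun γ => hx ▸ lp.norm_apply_le_norm (by simp) x γ, fun a ha => ?_⟩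
  have h1 : ENNReal.ofReal r ≤ ‖l1Apply a x‖ₑ := hrδ.le.trans (hδ.trans (iInf₂_le a ha))
  rw [← ofReal_norm] at h1
  exact (ENNReal.ofReal_le_ofReal_iff (norm_nonneg _)).1 h1

/-! ### Interlaced vectors and functionals -/

theorem exists_strong_rec {T : Type*} [Nonempty T] (F : ℕ → (ℕ → T) → T)
    (hF : ∀ k p p', (∀ j < k, p j = p' j) → F k p = F k p') :
    ∃ f : ℕ → T, ∀ k, f k = F k f := by
  inhabit T
  let G : ∀ k, (∀ j < k, T) → T := fun k p => F k fun j => if h : j < k then p j h else default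
  refine ⟨fun k => Nat.strongRecOn k G, fun k => ?_⟩
  dsimp only
  rw [Nat.strongRecOn_eq]
  exact hF _ _ _ fun j hj => by simp [hj]

set_option maxSynthPendingDepth 6 in
-- Course-of-values recursion on k. Because f s vanishes on X, Helly's theorem in X* allows g to
-- kill finitely many given vectors; Helly's theorem in X then lets x match z on finitely many given
-- functionals.
theorem exists_interlaced_approximation {X Γ σ : Type*} [NormedAddCommGroup X] [NormedSpace ℝ X]
    (supp : σ → Finset Γ) {c : ℝ} (z : Γ → StrongDual ℝ (StrongDual ℝ X)) (hz : ∀ γ, ‖z γ‖ < c)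
    (f : σ → StrongDual ℝ (StrongDual ℝ (StrongDual ℝ X))) (hf : ∀ s, ‖f s‖ < c)
    (hfX : ∀ s x, f s (NormedSpace.inclusionInDoubleDualLi (E := X) ℝ x) = 0) :
    ∃ (x : Γ → Finset σ → ℕ → X) (g : ℕ → Finset σ → σ → StrongDual ℝ X),
      (∀ γ α k, ‖x γ α k‖ < c) ∧ (∀ n β s, ‖g n β s‖ < c) ∧
      (∀ n β s, ∀ γ ∈ supp s, z γ (g n β s) = f s (z γ)) ∧
      (∀ n β s, ∀ k < n, ∀ α ⊆ β, ∀ γ ∈ supp s, g n β s (x γ α k) = 0) ∧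
      (∀ n β s, ∀ k ≥ n, ∀ α ⊇ β, s ∈ β → ∀ γ, g n β s (x γ α k) = z γ (g n β s)) := by
  classical
  let J := NormedSpace.inclusionInDoubleDualLi (E := X) ℝ
  have hG : ∀ (K : Finset X) (s : σ), ∃ g : StrongDual ℝ X, ‖g‖ < c ∧
      (∀ v ∈ K, g v = 0) ∧ ∀ γ ∈ supp s, z γ g = f s (z γ) := by
    intro K s
    obtain ⟨g, hg, hg'⟩ := exists_norm_lt_forall_apply_eq (f s) (hf s) (K.image J ∪ (supp s).image z)
    refine ⟨g, hg, fun v hv => ?_, fun γ hγ => ?_⟩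
    · have := hg' (J v) (Finset.mem_union_left _ (Finset.mem_image_of_mem _ hv))
      rw [hfX] at this
      exact this
    · exact hg' (z γ) (Finset.mem_union_right _ (Finset.mem_image_of_mem _ hγ))
  have hH : ∀ (Φ : Finset (StrongDual ℝ X)) (γ : Γ), ∃ v : X, ‖v‖ < c ∧ ∀ φ ∈ Φ, φ v = z γ φ :=
    fun Φ γ => exists_norm_lt_forall_apply_eq (z γ) (hz γ) Φ
  have : Nonempty (Γ → Finset σ → X) := ⟨fun _ _ => 0⟩
  choose G hGn hGK hGz using hG
  choose H hHn hHΦ using hH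
  -- The vectors that g n β s must kill; restricting γ to `supp s` keeps them finite in number.
  let K : (ℕ → Γ → Finset σ → X) → ℕ → Finset σ → σ → Finset X := fun p n β s =>
    (Finset.range n ×ˢ β.powerset ×ˢ supp s).image fun i => p i.1 i.2.2 i.2.1
  -- The functionals that x γ α k must respect. Level n = k is included: its functionals involve
  -- only vectors of levels below k, so the recursion is well founded.
  let Φ : (ℕ → Γ → Finset σ → X) → ℕ → Finset σ → Finset (StrongDual ℝ X) := fun p k α =>
    (Finset.range (k + 1) ×ˢ α.powerset ×ˢ α).image fun i => G (K p i.1 i.2.1 i.2.2) i.2.2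
  obtain ⟨x, hx⟩ := exists_strong_rec (T := Γ → Finset σ → X)
    (fun k p γ α => H (Φ p k α) γ) (by
      intro k p p' hp
      have hK : ∀ n ≤ k, ∀ β s, K p n β s = K p' n β s := fun n hn β s =>
        Finset.image_congr fun i hi => by
          have : i.1 < n := by simp at hi; exact hi.1
          simp only [hp i.1 (by omega)]
      have hΦ : ∀ α, Φ p k α = Φ p' k α := fun α =>
        Finset.image_congr fun i hi => by
          have : i.1 < k + 1 := by simp at hi; omega
          simp only [hK i.1 (by omega)]
      simp only [hΦ])
  refine ⟨fun γ α k => x k γ α, fun n β s => G (K x n β s) s, fun γ α k => ?_,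
    fun n β s => hGn _ _, fun n β s => hGz _ _, fun n β s k hk α hα γ hγ => ?_,
    fun n β s k hk α hα hs γ => ?_⟩
  · exact (congrFun₂ (hx k) γ α ▸ hHn _ _ : ‖x k γ α‖ < c)
  · refine hGK _ _ _ (Finset.mem_image.2 ⟨(k, α, γ), ?_, rfl⟩)
    simp [hk, hα, hγ]
  · have : x k γ α = H (Φ x k α) γ := by rw [hx]
    dsimp only
    rw [this]
    refine hHΦ _ _ _ (Finset.mem_image.2 ⟨(n, β, s), ?_, rfl⟩)
    simp only [Finset.mem_product, Finset.mem_range, Finset.mem_powerset]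
    exact ⟨by omega, hα, hα hs⟩

/-! ### Finitely supported elements and separation -/

theorem exists_ellOne_eq {Γ : Type u} (F : Finset Γ) (f : Γ → ℝ) (hf : ∀ γ ∉ F, f γ = 0) :
    ∃ a : EllOne Γ, ⇑a = f := by
  refine ⟨⟨f, memℓp_gen ?_⟩, rfl⟩
  refine summable_of_ne_finset_zero (s := F) fun γ hγ => ?_
  simp [hf γ hγ]

theorem norm_ellOne_eq_sum {Γ : Type u} (F : Finset Γ) (a : EllOne Γ) (ha : ∀ γ ∉ F, a γ = 0) :
    ‖a‖ = ∑ γ ∈ F, |a γ| := by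
  rw [lp.norm_eq_tsum_rpow (by simp), tsum_eq_sum (s := F)]
  · simp
  · intro γ hγ
    simp [ha γ hγ]

/-- Hahn–Banach separates C from the open ball of radius r at some level u; the separating
functional has norm at most u / r, so scaling by r / u suffices. -/
theorem exists_dual_le_apply_of_convex {W : Type*} [NormedAddCommGroup W] [NormedSpace ℝ W]
    {C : Set W} (hC : Convex ℝ C) {r : ℝ} (hr : 0 < r) (h : ∀ v ∈ C, r ≤ ‖v‖) :
    ∃ f : StrongDual ℝ W, ‖f‖ ≤ 1 ∧ ∀ v ∈ C, r ≤ f v := by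
  have hdisj : Disjoint (Metric.ball (0 : W) r) C := by
    rw [Set.disjoint_left]
    intro v hv hvC
    rw [mem_ball_zero_iff] at hv
    exact absurd (h v hvC) (not_le.2 hv)
  obtain ⟨f, u, hfb, hfC⟩ := geometric_hahn_banach_open (convex_ball 0 r) Metric.isOpen_ball hC hdisj
  have hu : 0 < u := by simpa using hfb 0 (by simpa using hr)
  have hcb : ∀ v ∈ Metric.closedBall (0 : W) r, f v ≤ u := by
    intro v hv
    rw [mem_closedBall_zero_iff] at hv
    by_contra! hlt
    have hfv : 0 < f v := hu.trans hlt
    have hq : u / f v < 1 := (div_lt_one hfv).2 hlt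
    have := hfb ((u / f v) • v) (by
      rw [mem_ball_zero_iff, norm_smul, Real.norm_of_nonneg (by positivity)]
      calc u / f v * ‖v‖ ≤ u / f v * r := by gcongr
        _ < 1 * r := by gcongr
        _ = r := one_mul r)
    rw [map_smul, smul_eq_mul, div_mul_cancel₀ _ hfv.ne'] at this
    exact lt_irrefl _ this
  have hfn : ‖f‖ ≤ u / r := by
    refine ContinuousLinearMap.opNorm_bound_of_ball_bound hr u f fun v hv => ?_
    rw [Real.norm_eq_abs, abs_le]
    have := hcb (-v) (by simpa using hv)
    rw [map_neg] at this
    exact ⟨by linarith, hcb v hv⟩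
  refine ⟨(r / u) • f, ?_, fun v hv => ?_⟩
  · rw [norm_smul, Real.norm_of_nonneg (by positivity)]
    calc r / u * ‖f‖ ≤ r / u * (u / r) := by gcongr
      _ = 1 := by field_simp
  · rw [smul_apply, smul_eq_mul, div_mul_eq_mul_div, le_div_iff₀ hu]
    gcongr
    exact hfC v hv

/-- A sign pattern fixes the support exactly, so only strictly positive weights are available. The
bound at the vertices follows by approximation from the relative interior of the simplex. -/
theorem exists_dual_le_apply_of_le_norm {Γ W : Type*} [NormedAddCommGroup W] [NormedSpace ℝ W]
    (F : Finset Γ) (hF : F.Nonempty) (y : Γ → W) {r : ℝ} (hr : 0 < r)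
    (h : ∀ w : Γ → ℝ, (∀ γ ∈ F, 0 < w γ) → ∑ γ ∈ F, w γ = 1 → r ≤ ‖∑ γ ∈ F, w γ • y γ‖) :
    ∃ f : StrongDual ℝ W, ‖f‖ ≤ 1 ∧ ∀ γ ∈ F, r ≤ f (y γ) := by
  classical
  let C : Set W := {v | ∃ w : Γ → ℝ, (∀ γ ∈ F, 0 < w γ) ∧ ∑ γ ∈ F, w γ = 1 ∧
    ∑ γ ∈ F, w γ • y γ = v}
  have hcard : (0 : ℝ) < F.card := by exact_mod_cast hF.card_pos
  have hC : Convex ℝ C := by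
    rintro _ ⟨w, hw, hw1, rfl⟩ _ ⟨w', hw', hw1', rfl⟩ a b ha hb hab
    refine ⟨fun γ => a * w γ + b * w' γ, fun γ hγ => ?_, ?_, ?_⟩
    · rcases ha.eq_or_lt with rfl | ha
      · have : b = 1 := by linarith
        simpa [this] using hw' γ hγ
      · have := mul_pos ha (hw γ hγ)
        have := mul_nonneg hb (hw' γ hγ).le
        linarith
    · rw [Finset.sum_add_distrib, ← Finset.mul_sum, ← Finset.mul_sum, hw1, hw1']
      linarith
    · simp only [add_smul, mul_smul, Finset.sum_add_distrib, Finset.smul_sum]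
  obtain ⟨f, hf, hfC⟩ := exists_dual_le_apply_of_convex hC hr (by
    rintro _ ⟨w, hw, hw1, rfl⟩
    exact h w hw hw1)
  refine ⟨f, hf, fun γ hγ => ?_⟩
  set p := f (y γ) with hp
  set q := ∑ i ∈ F, (F.card : ℝ)⁻¹ * f (y i) with hq
  -- The vertex γ is moved slightly towards the barycentre to make all weights positive.
  have key : ∀ η : ℝ, 0 < η → η < 1 → r ≤ (1 - η) * p + η * q := by
    intro η h0 h1
    have := hfC _ ⟨fun i => (1 - η) * (if i = γ then 1 else 0) + η * (F.card : ℝ)⁻¹,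
      fun i _ => ?_, ?_, rfl⟩
    · simp only [map_sum, map_smul, smul_eq_mul, add_mul, Finset.sum_add_distrib] at this
      rw [hq, Finset.mul_sum]
      simpa [hγ, mul_assoc] using this
    · have : 0 < η * (F.card : ℝ)⁻¹ := by positivity
      dsimp only
      split_ifs <;> linarith
    · rw [Finset.sum_add_distrib, ← Finset.mul_sum]
      simp [hγ]
      field_simp
      ring
  by_contra! hlt
  have hd : 0 < r - p := by linarith
  have hD : 0 < 2 * (r - p + |q - p|) := by positivity
  -- This η satisfies η |q - p| ≤ (r - p) / 2, so the perturbed value stays below r.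
  have hη := key ((r - p) / (2 * (r - p + |q - p|))) (by positivity)
    (by rw [div_lt_one hD]; linarith [abs_nonneg (q - p)])
  set η := (r - p) / (2 * (r - p + |q - p|)) with hηd
  have h1 : η * (2 * (r - p + |q - p|)) = r - p := div_mul_cancel₀ _ hD.ne'
  have h0 : 0 < η := by positivity
  nlinarith [mul_le_mul_of_nonneg_left (le_abs_self (q - p)) h0.le, mul_pos h0 hd]

/-- The conditions on `A` required by `DescribesRegular` that do not involve a class of spaces. -/
structure IsSignFamily {Γ : Type u} (A : Set (EllOne Γ)) : Prop where
  subset_sphere : A ⊆ Metric.sphere (0 : EllOne Γ) 1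
  finite_support : ∀ a ∈ A, (Function.support (a : Γ → ℝ)).Finite
  sign_closed : ∀ a₀ ∈ A, ∀ a ∈ Metric.sphere (0 : EllOne Γ) 1,
    (∀ γ, SignType.sign (a₀ γ) = SignType.sign (a γ)) → a ∈ A

theorem DescribesRegular.isSignFamily {P : BanachClass.{u}} {δ : ℝ} {Γ : Type u}
    {A : Set (EllOne Γ)} (h : DescribesRegular P δ A) : IsSignFamily A :=
  ⟨h.subset_sphere, h.finite_support, h.sign_closed⟩

namespace IsSignFamily

variable {Γ : Type u} {A : Set (EllOne Γ)}

theorem exists_finset (hA : IsSignFamily A) (s : admissibleSigns A) :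
    ∃ F : Finset Γ, F.Nonempty ∧ ∀ γ, γ ∈ F ↔ s.1 γ ≠ 0 := by
  obtain ⟨s, a, ha, hs⟩ := s
  have hF : ∀ γ, γ ∈ (hA.finite_support a ha).toFinset ↔ s γ ≠ 0 := fun γ => by
    simp [hs, sign_eq_zero_iff]
  refine ⟨_, ?_, hF⟩
  by_contra hne
  rw [Finset.not_nonempty_iff_eq_empty] at hne
  have h1 := hA.subset_sphere ha
  rw [mem_sphere_zero_iff_norm, norm_ellOne_eq_sum (hA.finite_support a ha).toFinset a
    (fun γ hγ => by simpa using hγ), hne] at h1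
  simp at h1

theorem exists_mem_eq (hA : IsSignFamily A) (s : admissibleSigns A) (F : Finset Γ)
    (hF : ∀ γ, γ ∈ F ↔ s.1 γ ≠ 0) (w : Γ → ℝ) (hw : ∀ γ ∈ F, 0 < w γ)
    (hw1 : ∑ γ ∈ F, w γ = 1) : ∃ a ∈ A, ∀ γ, a γ = w γ * (s.1 γ : ℝ) := by
  have h0 : ∀ γ ∉ F, s.1 γ = 0 := fun γ hγ => by
    by_contra h
    exact hγ ((hF γ).2 h)
  have hoff : ∀ γ ∉ F, w γ * (s.1 γ : ℝ) = 0 := fun γ hγ => by simp [h0 γ hγ]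
  obtain ⟨a, ha⟩ := exists_ellOne_eq F (fun γ => w γ * (s.1 γ : ℝ)) hoff
  obtain ⟨a₀, ha₀, hs⟩ := s.2
  have hsign : ∀ γ, SignType.sign (w γ * (s.1 γ : ℝ)) = s.1 γ := by
    intro γ
    by_cases hγ : γ ∈ F
    · rw [sign_mul, sign_pos (hw γ hγ), one_mul]
      cases s.1 γ <;> simp
    · simp [h0 γ hγ]
  refine ⟨a, hA.sign_closed a₀ ha₀ a ?_ fun γ => ?_, fun γ => by rw [ha]⟩
  · rw [mem_sphere_zero_iff_norm, norm_ellOne_eq_sum F a (by rw [ha]; exact hoff), ← hw1]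
    refine Finset.sum_congr rfl fun γ hγ => ?_
    have h1 : |(s.1 γ : ℝ)| = 1 := by
      have := (hF γ).1 hγ
      revert this
      cases s.1 γ <;> simp
    rw [ha, abs_mul, h1, mul_one, abs_of_pos (hw γ hγ)]
  · rw [ha, hsign, hs]

/-- By sign-closedness, every positively weighted average of the vectors s(γ) z(γ) is a(z) for some
a in A, so separation applies. -/
theorem exists_dual (hA : IsSignFamily A) {W : Type u} [NormedAddCommGroup W] [NormedSpace ℝ W]
    {r : ℝ} (hr : 0 < r) (z : Γ → W) (hz : ∀ a ∈ A, r ≤ ‖∑' γ, a γ • z γ‖)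
    (s : admissibleSigns A) (F : Finset Γ) (hne : F.Nonempty) (hF : ∀ γ, γ ∈ F ↔ s.1 γ ≠ 0) :
    ∃ f : StrongDual ℝ W, ‖f‖ ≤ 1 ∧ ∀ γ ∈ F, r ≤ (s.1 γ : ℝ) * f (z γ) := by
  obtain ⟨f, hf, hfr⟩ := exists_dual_le_apply_of_le_norm F hne (fun γ => (s.1 γ : ℝ) • z γ) hr
    (fun w hw hw1 => by
      obtain ⟨a, ha, haw⟩ := hA.exists_mem_eq s F hF w hw hw1
      refine (hz a ha).trans_eq ?_
      rw [tsum_eq_sum (s := F)]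
      · simp only [haw, mul_smul]
      · intro γ hγ
        have : s.1 γ = 0 := by
          by_contra h
          exact hγ ((hF γ).2 h)
        simp [haw, this])
  exact ⟨f, hf, fun γ hγ => by simpa using hfr γ hγ⟩

end IsSignFamily

/-! ### From the bidual quotient to the space -/

theorem mul_eq_abs_mul_of_sign_eq {e t : ℝ} {s : SignType} (h : SignType.sign e = s) :
    e * t = |e| * ((s : ℝ) * t) := by
  rw [← h, ← mul_assoc, abs_mul_sign]

theorem exists_forall_le_norm_coFamily {Γ X : Type u} [NormedAddCommGroup X] [NormedSpace ℝ X]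
    {A : Set (EllOne Γ)} (supp : admissibleSigns A → Finset Γ)
    (hsupp : ∀ s γ, γ ∈ supp s ↔ s.1 γ ≠ 0) {r c : ℝ}
    (z : Γ → StrongDual ℝ (StrongDual ℝ X)) (x : Γ → Finset (admissibleSigns A) → ℕ → X)
    (g : ℕ → Finset (admissibleSigns A) → admissibleSigns A → StrongDual ℝ X)
    (hg : ∀ n β s, ‖g n β s‖ < c)
    (hgz : ∀ n β s m β', ∀ γ ∈ supp s, z γ (g n β s) = z γ (g m β' s))
    (hr : ∀ n β s, ∀ γ ∈ supp s, r ≤ (s.1 γ : ℝ) * z γ (g n β s))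
    (hg0 : ∀ n β s, ∀ k < n, ∀ α ⊆ β, ∀ γ ∈ supp s, g n β s (x γ α k) = 0)
    (hgx : ∀ n β s, ∀ k ≥ n, ∀ α ⊇ β, s ∈ β → ∀ γ, g n β s (x γ α k) = z γ (g n β s)) :
    ∀ e ∈ coFamily A, r ≤ 3 * c * ‖∑' i, e i • x i.1 i.2.1 i.2.2‖ := by
  classical
  rintro e ⟨he1, hefin, β, s, n, hs, he⟩
  set T := hefin.toFinset with hT
  have hoff : ∀ i ∉ T, e i = 0 := fun i hi => by simpa [hT] using hi
  rw [mem_sphere_zero_iff_norm, norm_ellOne_eq_sum T e hoff] at he1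
  -- On early coordinates the second functional vanishes; on late ones both agree with z, whose
  -- values at them coincide, so h changes sign. Level n + 1 separates k ≤ n from k > n.
  let h : StrongDual ℝ X := g 0 {s} s - (2 : ℝ) • g (n + 1) β s
  have hc : ‖h‖ ≤ 3 * c := by
    calc ‖h‖ ≤ ‖g 0 {s} s‖ + ‖(2 : ℝ) • g (n + 1) β s‖ := norm_sub_le _ _
      _ = ‖g 0 {s} s‖ + 2 * ‖g (n + 1) β s‖ := by rw [norm_smul, Real.norm_ofNat]
      _ ≤ c + 2 * c := by gcongr <;> exact (hg _ _ _).le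
      _ = 3 * c := by ring
  have hterm : ∀ i ∈ T, |e i| * r ≤ e i * h (x i.1 i.2.1 i.2.2) := by
    rintro ⟨γ, α, k⟩ hi
    have hne : e (γ, α, k) ≠ 0 := by simpa [hT] using hi
    have hsne : SignType.sign (e (γ, α, k)) ≠ 0 := by simpa using hne
    have hh : h (x γ α k) = g 0 {s} s (x γ α k) - 2 * g (n + 1) β s (x γ α k) := by simp [h]
    dsimp only
    rw [hh]
    rcases he γ α k hne with ⟨hsα, hαβ, hk, hsign⟩ | ⟨hβα, hk, hsign⟩
    · have hγ : γ ∈ supp s := (hsupp s γ).2 (hsign ▸ hsne)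
      rw [hgx 0 {s} s k (Nat.zero_le _) α (by simpa using hsα) (by simp),
        hg0 (n + 1) β s k (by omega) α hαβ γ hγ, mul_zero, sub_zero,
        mul_eq_abs_mul_of_sign_eq hsign]
      gcongr
      exact hr _ _ _ _ hγ
    · have hγ : γ ∈ supp s := (hsupp s γ).2 fun h0 => hsne (by rw [hsign, h0]; rfl)
      rw [hgx 0 {s} s k (Nat.zero_le _) α (by simpa using hβα hs) (by simp),
        hgx (n + 1) β s k hk α hβα hs, hgz (n + 1) β s 0 {s} γ hγ, mul_eq_abs_mul_of_sign_eq hsign]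
      gcongr
      have := hr 0 {s} s γ hγ
      rw [SignType.coe_neg]
      linarith
  rw [tsum_eq_sum (s := T) (fun i hi => by rw [hoff i hi, zero_smul])]
  calc r = ∑ i ∈ T, |e i| * r := by rw [← Finset.sum_mul, he1, one_mul]
    _ ≤ ∑ i ∈ T, e i * h (x i.1 i.2.1 i.2.2) := Finset.sum_le_sum hterm
    _ = h (∑ i ∈ T, e i • x i.1 i.2.1 i.2.2) := by simp only [map_sum, map_smul, smul_eq_mul]
    _ ≤ ‖h (∑ i ∈ T, e i • x i.1 i.2.1 i.2.2)‖ := Real.le_norm_self _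
    _ ≤ ‖h‖ * ‖∑ i ∈ T, e i • x i.1 i.2.1 i.2.2‖ := h.le_opNorm _
    _ ≤ _ := by gcongr

theorem IsSignFamily.coFamily_nonempty {Γ : Type u} {A : Set (EllOne Γ)} (hA : IsSignFamily A)
    (hne : A.Nonempty) : (coFamily A).Nonempty := by
  classical
  obtain ⟨a, ha⟩ := hne
  let s : admissibleSigns A := ⟨fun γ => SignType.sign (a γ), a, ha, fun _ => rfl⟩
  obtain ⟨F, ⟨γ, hγ⟩, hF⟩ := hA.exists_finset s
  have hs := (hF γ).1 hγ
  let i : CoIndex A := (γ, {s}, 0)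
  obtain ⟨e, he⟩ := exists_ellOne_eq {i} (fun j => if j = i then (s.1 γ : ℝ) else 0)
    (fun j hj => by simpa using fun h => absurd h (by simpa using hj))
  have hoff : ∀ j ∉ ({i} : Finset (CoIndex A)), e j = 0 := fun j hj => by
    have : j ≠ i := by simpa using hj
    simp [he, this]
  refine ⟨e, ?_, ?_, {s}, s, 0, by simp, fun γ' α k h => Or.inl ?_⟩
  · rw [mem_sphere_zero_iff_norm, norm_ellOne_eq_sum {i} e hoff]
    revert hs
    simp only [he, Finset.sum_singleton, if_true]
    cases s.1 γ <;> simp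
  · refine ({i} : Finset (CoIndex A)).finite_toSet.subset fun j hj => ?_
    by_contra h
    exact hj (hoff j h)
  · have hi : (γ', α, k) = i := by
      by_contra h'
      exact h (hoff _ (by simpa using h'))
    have hsign : SignType.sign (e i) = s.1 γ := by
      simp only [he, if_true]
      cases s.1 γ <;> simp
    rw [hi, hsign]
    simp only [i, Prod.mk.injEq] at hi
    obtain ⟨rfl, rfl, rfl⟩ := hi
    simp

/-- The Banach space `X** / X`. -/
abbrev BidualQuotient (X : Type u) [NormedAddCommGroup X] [NormedSpace ℝ X] : Type u :=
  QuotientByImage (E := X) (F := StrongDual ℝ (StrongDual ℝ X))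
    (NormedSpace.inclusionInDoubleDualLi (E := X) ℝ)

set_option maxSynthPendingDepth 6 in
theorem IsSignFamily.ofReal_le_l1Index_coFamily {Γ X : Type u} [NormedAddCommGroup X]
    [NormedSpace ℝ X] [CompleteSpace X] {A : Set (EllOne Γ)} (hA : IsSignFamily A)
    (hne : A.Nonempty) {r r' : ℝ} (hr' : 0 < r') (hrr : r' < r)
    (z : Γ → BidualQuotient X)
    (hz : ∀ γ, ‖z γ‖ ≤ 1) (hzA : ∀ a ∈ A, r ≤ ‖∑' γ, a γ • z γ‖) :
    ENNReal.ofReal (r' / 3) ≤ l1Index X (coFamily A) := by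
  have hr : 0 < r := hr'.trans hrr
  -- One factor c is lost to the norms of the functionals, the other to normalizing the vectors x.
  obtain ⟨c, hc1, hc⟩ : ∃ c : ℝ, 1 < c ∧ r' * (c * c) = r := by
    refine ⟨√(r / r'), ?_, ?_⟩
    · rw [Real.lt_sqrt zero_le_one, one_pow, one_lt_div hr']
      exact hrr
    · rw [Real.mul_self_sqrt (by positivity)]
      field_simp
  have hc0 : 0 < c := by linarith
  have hlift : ∀ γ, ∃ v : StrongDual ℝ (StrongDual ℝ X), Submodule.Quotient.mk v = z γ ∧ ‖v‖ < c := by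
    intro γ
    obtain ⟨v, hv, hvn⟩ := Submodule.Quotient.norm_mk_lt (z γ) (sub_pos.2 ((hz γ).trans_lt hc1))
    exact ⟨v, hv, by linarith⟩
  choose v hvz hvc using hlift
  choose supp hsuppne hsupp using hA.exists_finset
  have hdual := fun s => hA.exists_dual hr z hzA s (supp s) (hsuppne s) (hsupp s)
  choose f hf hfr using hdual
  let M := LinearMap.range (NormedSpace.inclusionInDoubleDualLi (E := X) ℝ).toLinearMap
  let q : StrongDual ℝ (StrongDual ℝ X) →L[ℝ] BidualQuotient X :=
    M.mkQ.mkContinuous 1 fun y => by simpa using Submodule.Quotient.norm_mk_le M y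
  have hq : ‖q‖ ≤ 1 := LinearMap.mkContinuous_norm_le _ zero_le_one _
  obtain ⟨x, g, hx, hg, hgz, hg0, hgx⟩ := exists_interlaced_approximation supp v hvc
    (fun s => (f s).comp q)
    (fun s => by
      calc ‖(f s).comp q‖ ≤ ‖f s‖ * ‖q‖ := ContinuousLinearMap.opNorm_comp_le _ _
        _ ≤ 1 * 1 := by gcongr; exact hf s
        _ < c := by linarith)
    (fun s y => by
      have : q (NormedSpace.inclusionInDoubleDualLi (E := X) ℝ y) = 0 :=
        (Submodule.Quotient.mk_eq_zero M).2 ⟨y, rfl⟩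
      rw [ContinuousLinearMap.comp_apply, this, map_zero])
  have hqv : ∀ γ, q (v γ) = z γ := hvz
  simp only [ContinuousLinearMap.comp_apply, hqv] at hgz
  have hE := exists_forall_le_norm_coFamily supp hsupp (r := r) v x g hg
    (fun n β s m β' γ hγ => by rw [hgz n β s γ hγ, hgz m β' s γ hγ])
    (fun n β s γ hγ => by rw [hgz n β s γ hγ]; exact hfr s γ hγ) hg0 hgx
  refine ofReal_le_l1Index (hA.coFamily_nonempty hne) (by positivity)
    (fun i => c⁻¹ • x i.1 i.2.1 i.2.2) (fun i => ?_) fun e he => ?_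
  · rw [norm_smul, Real.norm_of_nonneg (by positivity), inv_mul_le_one₀ hc0]
    exact (hx _ _ _).le
  · have h1 := hE e he
    have h2 : ∑' i, e i • c⁻¹ • x i.1 i.2.1 i.2.2 = c⁻¹ • ∑' i, e i • x i.1 i.2.1 i.2.2 := by
      rw [← tsum_const_smul'']
      exact tsum_congr fun i => smul_comm _ _ _
    rw [h2, norm_smul, Real.norm_of_nonneg (by positivity), ← hc] at *
    set N := ‖∑' i, e i • x i.1 i.2.1 i.2.2‖
    have h3 : r' * c ≤ 3 * N := by
      refine le_of_mul_le_mul_right ?_ hc0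
      linarith
    rw [inv_mul_eq_div, div_le_div_iff₀ (by norm_num) hc0]
    linarith

/-! ### From the space to the bidual quotient -/

open Filter Topology in
-- Banach–Alaoglu: the images of the x i lie in the weak* compact unit ball of the bidual.
theorem exists_weakStar_limit {X ι : Type*} [NormedAddCommGroup X] [NormedSpace ℝ X]
    (U : Ultrafilter ι) (x : ι → X) (hx : ∀ i, ‖x i‖ ≤ 1) :
    ∃ v : StrongDual ℝ (StrongDual ℝ X), ‖v‖ ≤ 1 ∧
      ∀ g : StrongDual ℝ X, Tendsto (fun i => g (x i)) U (𝓝 (v g)) := by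
  let J := NormedSpace.inclusionInDoubleDualLi (E := X) ℝ
  let j : ι → WeakDual ℝ (StrongDual ℝ X) := fun i => StrongDual.toWeakDual (J (x i))
  have hK := WeakDual.isCompact_closedBall (𝕜 := ℝ) (E := StrongDual ℝ X) 0 1
  obtain ⟨v, hv, hle⟩ := hK.ultrafilter_le_nhds (U.map j) (by
    rw [le_principal_iff]
    refine Filter.mem_map.2 (Filter.Eventually.of_forall fun i => ?_)
    simpa [j] using (J.norm_map (x i)).trans_le (hx i))
  refine ⟨WeakDual.toStrongDual v, by simpa using hv, fun g => ?_⟩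
  exact ((WeakDual.eval_continuous g).tendsto v).comp (show Tendsto j U (𝓝 v) from hle)

open Filter Topology in
/-- Mazur's theorem: a point of `X` at distance less than `r` from a weak* limit in the bidual is
at distance less than `r` from the convex combinations of the tail. -/
theorem exists_convexCombination_norm_sub_lt {X ι : Type*} [NormedAddCommGroup X]
    [NormedSpace ℝ X] (U : Filter ι) [U.NeBot] (x : ι → X) (v : StrongDual ℝ (StrongDual ℝ X))
    (hv : ∀ g : StrongDual ℝ X, Tendsto (fun i => g (x i)) U (𝓝 (v g))) {I : Set ι} (hI : I ∈ U)
    {y : X} {r : ℝ} (hr : ‖v - NormedSpace.inclusionInDoubleDualLi (E := X) ℝ y‖ < r) :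
    ∃ w : ι →₀ ℝ, (∀ i, 0 ≤ w i) ∧ (∀ i, w i ≠ 0 → i ∈ I) ∧ ∑ i ∈ w.support, w i = 1 ∧
      ‖∑ i ∈ w.support, w i • x i - y‖ < r := by
  by_contra! hcon
  let D : Set (ι →₀ ℝ) := {w | (∀ i, 0 ≤ w i) ∧ (∀ i ∉ I, w i = 0) ∧
    Finsupp.linearCombination ℝ (fun _ => (1 : ℝ)) w = 1}
  have hD : Convex ℝ D := by
    rintro w ⟨h1, h2, h3⟩ w' ⟨h1', h2', h3'⟩ a b ha hb hab
    refine ⟨fun i => ?_, fun i hi => ?_, ?_⟩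
    · simpa using add_nonneg (mul_nonneg ha (h1 i)) (mul_nonneg hb (h1' i))
    · simp [h2 i hi, h2' i hi]
    · rw [map_add, map_smul, map_smul, h3, h3', smul_eq_mul, smul_eq_mul, mul_one, mul_one, hab]
  have hC := hD.linear_image (Finsupp.linearCombination ℝ fun i => x i - y)
  -- If all tail combinations stay at distance r from y, one f of norm at most 1 is at least r on
  -- every x i - y with i in I; in the limit this contradicts the distance from v to y.
  obtain ⟨f, hf, hfC⟩ := exists_dual_le_apply_of_convex hC
    ((norm_nonneg (v - NormedSpace.inclusionInDoubleDualLi (E := X) ℝ y)).trans_lt hr) (by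
    rintro _ ⟨w, ⟨h1, h2, h3⟩, rfl⟩
    have h3 : ∑ i ∈ w.support, w i = 1 := by
      simpa [Finsupp.linearCombination_apply, Finsupp.sum] using h3
    have := hcon w h1 (fun i hi => by_contra fun h => hi (h2 i h)) h3
    simpa [Finsupp.linearCombination_apply, Finsupp.sum, smul_sub, Finset.sum_sub_distrib,
      ← Finset.sum_smul, h3] using this)
  have hlim : r ≤ v f - f y := by
    refine ge_of_tendsto ((hv f).sub_const (f y)) ?_
    filter_upwards [hI] with i hi
    have := hfC (x i - y) ⟨Finsupp.single i 1, ⟨fun j => ?_, fun j hj => ?_, by simp⟩, by simp⟩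
    · simpa using this
    · classical
      rw [Finsupp.single_apply]
      split_ifs <;> simp
    · exact Finsupp.single_eq_of_ne fun h => hj (h ▸ hi)
  have : v f - f y ≤ ‖v - NormedSpace.inclusionInDoubleDualLi (E := X) ℝ y‖ * ‖f‖ :=
    (Real.le_norm_self _).trans
      ((v - NormedSpace.inclusionInDoubleDualLi (E := X) ℝ y).le_opNorm f)
  have : ‖v - NormedSpace.inclusionInDoubleDualLi (E := X) ℝ y‖ * ‖f‖ ≤
      ‖v - NormedSpace.inclusionInDoubleDualLi (E := X) ℝ y‖ :=
    mul_le_of_le_one_right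
      (norm_nonneg (v - NormedSpace.inclusionInDoubleDualLi (E := X) ℝ y)) hf
  linarith

/-- Half the difference of an early and a late convex combination gives an element of
`coFamily A`. -/
theorem IsSignFamily.exists_mem_coFamily {Γ : Type u} {A : Set (EllOne Γ)} (hA : IsSignFamily A)
    {a : EllOne Γ} (ha : a ∈ A) (s : admissibleSigns A)
    (hs : ∀ γ, s.1 γ = SignType.sign (a γ)) (F : Finset Γ) (hF : ∀ γ ∉ F, a γ = 0)
    (β : Finset (admissibleSigns A)) (hsβ : s ∈ β) (n : ℕ)
    (w w' : (Finset (admissibleSigns A) × ℕ) →₀ ℝ) (hw : ∀ i, 0 ≤ w i) (hw' : ∀ i, 0 ≤ w' i)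
    (hwI : ∀ i, w i ≠ 0 → s ∈ i.1 ∧ i.1 ⊆ β ∧ i.2 ≤ n) (hwI' : ∀ i, w' i ≠ 0 → β ⊆ i.1 ∧ n < i.2)
    (hw1 : ∑ i ∈ w.support, w i = 1) (hw1' : ∑ i ∈ w'.support, w' i = 1) :
    ∃ e ∈ coFamily A, ∀ {X : Type u} [NormedAddCommGroup X] [NormedSpace ℝ X]
      (x : CoIndex A → X), ∑' i, e i • x i = (2⁻¹ : ℝ) •
        (∑ i ∈ w.support, w i • ∑ γ ∈ F, a γ • x (γ, i) -
          ∑ i ∈ w'.support, w' i • ∑ γ ∈ F, a γ • x (γ, i)) := by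
  classical
  let T := w.support ∪ w'.support
  have hT : ∀ i ∉ T, w i = 0 ∧ w' i = 0 := fun i hi => by
    simpa [T, not_or] using hi
  have hoff : ∀ j ∉ F ×ˢ T, 2⁻¹ * a j.1 * (w j.2 - w' j.2) = 0 := by
    rintro ⟨γ, i⟩ hj
    rw [Finset.mem_product, not_and_or] at hj
    rcases hj with h | h
    · simp [hF γ h]
    · simp [hT i h]
  obtain ⟨e, he⟩ := exists_ellOne_eq (F ×ˢ T)
    (fun j : CoIndex A => 2⁻¹ * a j.1 * (w j.2 - w' j.2)) hoff
  have heoff : ∀ j ∉ F ×ˢ T, e j = 0 := by rw [he]; exact hoff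
  -- The levels k ≤ n and k > n are disjoint, so nothing cancels and e has norm exactly 1.
  have hdis : ∀ i, w i = 0 ∨ w' i = 0 := fun i => by
    by_contra! h
    have h1 := (hwI i h.1).2.2
    have h2 := (hwI' i h.2).2
    omega
  have habs : ∀ i, |w i - w' i| = w i + w' i := fun i => by
    rcases hdis i with h | h
    · rw [h, zero_sub, zero_add, abs_neg, abs_of_nonneg (hw' i)]
    · rw [h, sub_zero, add_zero, abs_of_nonneg (hw i)]
  have hTw : ∑ i ∈ T, w i = 1 := by
    rw [← hw1]
    exact (Finset.sum_subset Finset.subset_union_left fun i _ hi => by simpa using hi).symm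
  have hTw' : ∑ i ∈ T, w' i = 1 := by
    rw [← hw1']
    exact (Finset.sum_subset Finset.subset_union_right fun i _ hi => by simpa using hi).symm
  have ha1 : ∑ γ ∈ F, |a γ| = 1 := by
    rw [← norm_ellOne_eq_sum F a hF, ← mem_sphere_zero_iff_norm]
    exact hA.subset_sphere ha
  refine ⟨e, ⟨?_, ?_, β, s, n, hsβ, fun γ α k hne => ?_⟩, ?_⟩
  · rw [mem_sphere_zero_iff_norm, norm_ellOne_eq_sum _ e heoff, Finset.sum_product]
    simp only [he, abs_mul, habs]
    simp only [← Finset.mul_sum, ← Finset.sum_mul, Finset.sum_add_distrib, hTw, hTw', ha1]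
    norm_num
  · refine (F ×ˢ T).finite_toSet.subset fun j hj => ?_
    by_contra h
    exact hj (heoff j h)
  · have he' : e (γ, α, k) = 2⁻¹ * a γ * (w (α, k) - w' (α, k)) := by rw [he]
    have h2 : SignType.sign (2⁻¹ : ℝ) = 1 := sign_pos (by norm_num)
    rcases hdis (α, k) with h | h
    · have hne' : w' (α, k) ≠ 0 := fun h' => hne (by rw [he', h, h', sub_zero, mul_zero])
      have hpos := (hw' (α, k)).lt_of_ne' hne'
      refine Or.inr ⟨(hwI' _ hne').1, (hwI' _ hne').2, ?_⟩
      rw [he', sign_mul, sign_mul, h2, hs,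
        sign_neg (show w (α, k) - w' (α, k) < 0 by linarith)]
      simp
    · have hne' : w (α, k) ≠ 0 := fun h' => hne (by rw [he', h, h', sub_zero, mul_zero])
      have hpos := (hw (α, k)).lt_of_ne' hne'
      obtain ⟨h3, h4, h5⟩ := hwI _ hne'
      refine Or.inl ⟨h3, h4, h5, ?_⟩
      rw [he', sign_mul, sign_mul, h2, hs,
        sign_pos (show 0 < w (α, k) - w' (α, k) by linarith)]
      simp
  · intro X _ _ x
    have h1 : ∑ i ∈ w.support, w i • ∑ γ ∈ F, a γ • x (γ, i) =
        ∑ i ∈ T, w i • ∑ γ ∈ F, a γ • x (γ, i) :=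
      Finset.sum_subset Finset.subset_union_left fun i _ hi => by
        rw [Finsupp.notMem_support_iff.1 hi, zero_smul]
    have h2 : ∑ i ∈ w'.support, w' i • ∑ γ ∈ F, a γ • x (γ, i) =
        ∑ i ∈ T, w' i • ∑ γ ∈ F, a γ • x (γ, i) :=
      Finset.sum_subset Finset.subset_union_right fun i _ hi => by
        rw [Finsupp.notMem_support_iff.1 hi, zero_smul]
    rw [h1, h2, ← Finset.sum_sub_distrib,
      tsum_eq_sum (s := F ×ˢ T) (fun j hj => by rw [heoff j hj, zero_smul]),
      Finset.sum_product_right, Finset.smul_sum]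
    refine Finset.sum_congr rfl fun i _ => ?_
    rw [← sub_smul, Finset.smul_sum, Finset.smul_sum]
    refine Finset.sum_congr rfl fun γ _ => ?_
    simp only [he, smul_smul]
    congr 1
    ring

open Filter Topology in
theorem IsSignFamily.exists_forall_le_norm_sub {Γ X : Type u} [NormedAddCommGroup X]
    [NormedSpace ℝ X] {A : Set (EllOne Γ)} (hA : IsSignFamily A)
    {r : ℝ} (x : CoIndex A → X) (hx : ∀ i, ‖x i‖ ≤ 1)
    (hxE : ∀ e ∈ coFamily A, r ≤ ‖∑' i, e i • x i‖) :
    ∃ v : Γ → StrongDual ℝ (StrongDual ℝ X), (∀ γ, ‖v γ‖ ≤ 1) ∧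
      ∀ a ∈ A, ∀ F : Finset Γ, (∀ γ ∉ F, a γ = 0) → ∀ y : X,
        r ≤ ‖∑ γ ∈ F, a γ • v γ - NormedSpace.inclusionInDoubleDualLi (E := X) ℝ y‖ := by
  classical
  -- A single ultrafilter serves all γ, so finite combinations converge too.
  let U : Ultrafilter (Finset (admissibleSigns A) × ℕ) := Ultrafilter.of atTop
  have hU : ∀ β n, {i : Finset (admissibleSigns A) × ℕ | β ⊆ i.1 ∧ n < i.2} ∈
      (U : Filter (Finset (admissibleSigns A) × ℕ)) := fun β n =>
    Ultrafilter.of_le atTop <| mem_of_superset (mem_atTop (β, n + 1)) fun _ h => h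
  choose v hv hlim using fun γ => exists_weakStar_limit U (fun i => x (γ, i)) fun i => hx _
  refine ⟨v, hv, fun a ha F hF y => ?_⟩
  by_contra! hdist
  let s : admissibleSigns A := ⟨fun γ => SignType.sign (a γ), a, ha, fun _ => rfl⟩
  have hlim' : ∀ g : StrongDual ℝ X, Tendsto (fun i => g (∑ γ ∈ F, a γ • x (γ, i))) U
      (𝓝 ((∑ γ ∈ F, a γ • v γ) g)) := by
    intro g
    simp only [map_sum, map_smul, sum_apply, smul_apply]
    exact tendsto_finsetSum _ fun γ _ => (hlim γ g).const_smul (a γ)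
  obtain ⟨w, hw0, hwI, hw1, hwn⟩ := exists_convexCombination_norm_sub_lt _ _ _ hlim'
    (hU {s} 0) hdist
  -- β and n bound the indices of the early combination; the late one is taken strictly beyond them.
  let β := {s} ∪ w.support.biUnion Prod.fst
  let n := w.support.sup Prod.snd
  obtain ⟨w', hw0', hwI', hw1', hwn'⟩ :=
    exists_convexCombination_norm_sub_lt _ _ _ hlim' (hU β n) hdist
  obtain ⟨e, he, hex⟩ := hA.exists_mem_coFamily ha s (fun _ => rfl) F hF β
    (Finset.mem_union_left _ (Finset.mem_singleton_self s)) n w w' hw0 hw0'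
    (fun i hi => ⟨Finset.singleton_subset_iff.1 (hwI i hi).1,
      (Finset.subset_biUnion_of_mem Prod.fst (Finsupp.mem_support_iff.2 hi)).trans
        Finset.subset_union_right,
      Finset.le_sup (f := Prod.snd) (Finsupp.mem_support_iff.2 hi)⟩) hwI' hw1 hw1'
  have h1 := hxE e he
  rw [hex, norm_smul, Real.norm_of_nonneg (by norm_num)] at h1
  have h2 := norm_sub_le_norm_sub_add_norm_sub (∑ i ∈ w.support, w i • ∑ γ ∈ F, a γ • x (γ, i)) y
    (∑ i ∈ w'.support, w' i • ∑ γ ∈ F, a γ • x (γ, i))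
  rw [norm_sub_rev y] at h2
  linarith

/-- The quotient norm is the distance to the range of j. -/
theorem IsSignFamily.exists_forall_le_norm_mk {Γ X W : Type u} [NormedAddCommGroup X]
    [NormedSpace ℝ X] [CompleteSpace X] [NormedAddCommGroup W] [NormedSpace ℝ W] (j : X →ₗᵢ[ℝ] W)
    {A : Set (EllOne Γ)} (hA : IsSignFamily A) {r : ℝ} (v : Γ → W) (hv : ∀ γ, ‖v γ‖ ≤ 1)
    (h : ∀ a ∈ A, ∀ F : Finset Γ, (∀ γ ∉ F, a γ = 0) → ∀ y : X,
      r ≤ ‖∑ γ ∈ F, a γ • v γ - j y‖) :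
    ∃ z : Γ → QuotientByImage j, (∀ γ, ‖z γ‖ ≤ 1) ∧ ∀ a ∈ A, r ≤ ‖∑' γ, a γ • z γ‖ := by
  let M := LinearMap.range j.toLinearMap
  refine ⟨fun γ => M.mkQ (v γ), fun γ => (Submodule.Quotient.norm_mk_le M _).trans (hv γ),
    fun a ha => ?_⟩
  by_contra! hlt
  have hF : ∀ γ ∉ (hA.finite_support a ha).toFinset, a γ = 0 := fun γ hγ => by simpa using hγ
  rw [tsum_eq_sum (s := (hA.finite_support a ha).toFinset)
    (fun γ hγ => by rw [hF γ hγ, zero_smul])] at hlt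
  simp only [← map_smul, ← map_sum] at hlt
  obtain ⟨v', hv', hn⟩ := Submodule.Quotient.norm_mk_lt
    (M.mkQ (∑ γ ∈ (hA.finite_support a ha).toFinset, a γ • v γ)) (sub_pos.2 hlt)
  obtain ⟨y, hy⟩ := (Submodule.Quotient.eq M).1 hv'.symm
  have := h a ha _ hF y
  rw [show j y = _ from hy, sub_sub_cancel] at this
  linarith

theorem IsSignFamily.exists_forall_le_norm_quotient {Γ X : Type u} [NormedAddCommGroup X]
    [NormedSpace ℝ X] [CompleteSpace X] {A : Set (EllOne Γ)} (hA : IsSignFamily A)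
    {r : ℝ} (x : CoIndex A → X) (hx : ∀ i, ‖x i‖ ≤ 1)
    (hxE : ∀ e ∈ coFamily A, r ≤ ‖∑' i, e i • x i‖) :
    ∃ z : Γ → BidualQuotient X,
      (∀ γ, ‖z γ‖ ≤ 1) ∧ ∀ a ∈ A, r ≤ ‖∑' γ, a γ • z γ‖ := by
  obtain ⟨v, hv, h⟩ := hA.exists_forall_le_norm_sub x hx hxE
  exact hA.exists_forall_le_norm_mk _ v hv h

/-! ### The description of the coclass -/

theorem IsSignFamily.coFamily_sign_closed {Γ : Type u} {A : Set (EllOne Γ)} :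
    ∀ e₀ ∈ coFamily A, ∀ e ∈ Metric.sphere (0 : EllOne (CoIndex A)) 1,
      (∀ i, SignType.sign (e₀ i) = SignType.sign (e i)) → e ∈ coFamily A := by
  rintro e₀ ⟨_, hfin, β, s, n, hs, he₀⟩ e he hsign
  have h0 : ∀ i, e₀ i = 0 ↔ e i = 0 := fun i => by
    rw [← sign_eq_zero_iff, hsign, sign_eq_zero_iff]
  refine ⟨he, hfin.subset fun i hi => mt (h0 i).1 hi, β, s, n, hs, fun γ α k hne => ?_⟩
  rw [← hsign]
  exact he₀ γ α k (mt (h0 _).1 hne)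

theorem ofReal_le_of_forall_lt {t : ℝ} {m : ℝ≥0∞} (ht : 0 < t)
    (h : ∀ r, 0 < r → r < t → ENNReal.ofReal r ≤ m) : ENNReal.ofReal t ≤ m := by
  by_contra! hlt
  have hm : m ≠ ∞ := hlt.ne_top
  have h1 : m.toReal < t := (ENNReal.lt_ofReal_iff_toReal_lt hm).1 hlt
  have h0 : 0 ≤ m.toReal := ENNReal.toReal_nonneg
  have h2 := h ((m.toReal + t) / 2) (by linarith) (by linarith)
  have := (ENNReal.ofReal_le_iff_le_toReal hm).1 h2
  linarith

set_option maxSynthPendingDepth 6 in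
theorem DescribesRegular.coclass_coFamily {P : BanachClass.{u}} {δ : ℝ} {Γ : Type u}
    {A : Set (EllOne Γ)} (hne : A.Nonempty) (h : DescribesRegular P δ A) :
    DescribesRegular (coclass P) (δ / 3) (coFamily A) := by
  have hA := h.isSignFamily
  have hδ := h.pos
  have hlow : ∀ (X : Type u) [NormedAddCommGroup X] [NormedSpace ℝ X] [CompleteSpace X],
      ¬ coclass P X → ENNReal.ofReal (δ / 3) ≤ l1Index X (coFamily A) := by
    intro X _ _ _ hX
    have h1 := (h.notMem_iff_le_index (BidualQuotient X)).1 hX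
    refine ofReal_le_of_forall_lt (by positivity) fun r hr hrδ => ?_
    -- The midpoint of 3r and δ leaves room twice: below the possibly unattained index, and for the
    -- factor c².
    obtain ⟨z, hz, hzA⟩ := exists_of_lt_l1Index (X := BidualQuotient X) (r := (3 * r + δ) / 2)
      (((ENNReal.ofReal_lt_ofReal_iff hδ).2 (by linarith)).trans_le h1)
    have := hA.ofReal_le_l1Index_coFamily hne (r' := 3 * r) (by positivity) (by linarith) z hz hzA
    rwa [mul_div_cancel_left₀ r three_ne_zero] at this
  have hup : ∀ (X : Type u) [NormedAddCommGroup X] [NormedSpace ℝ X] [CompleteSpace X],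
      0 < l1Index X (coFamily A) → ¬ coclass P X := by
    intro X _ _ _ hX
    obtain ⟨m, hm0, hm⟩ := ENNReal.lt_iff_exists_real_btwn.1 hX
    obtain ⟨x, hx, hxE⟩ := exists_of_lt_l1Index hm.2
    have hm1 : 0 < m := ENNReal.ofReal_pos.1 hm.1
    obtain ⟨z, hz, hzA⟩ := hA.exists_forall_le_norm_quotient x hx hxE
    refine (h.notMem_iff_index_pos (BidualQuotient X)).2 ?_
    exact (ENNReal.ofReal_pos.2 hm1).trans_le (ofReal_le_l1Index hne hm1 z hz hzA)
  have hpos : 0 < ENNReal.ofReal (δ / 3) := ENNReal.ofReal_pos.2 (by positivity)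
  exact ⟨by positivity, fun e he => he.1, fun e he => he.2.1, IsSignFamily.coFamily_sign_closed,
    fun X _ _ _ => ⟨fun hX => hpos.trans_le (hlow X hX), hup X⟩,
    fun X _ _ _ => ⟨hlow X, fun hX => hup X (hpos.trans_le hX)⟩⟩

/-! ### The empty family -/

theorem l1Index_eq_zero_of_isEmpty {Γ X : Type u} [NormedAddCommGroup X] [NormedSpace ℝ X]
    (A : Set (EllOne Γ)) (h : IsEmpty Γ ∨ Subsingleton X) : l1Index X A = 0 := by
  refine sSup_eq_bot.2 ?_
  rintro δ ⟨x, hx, -⟩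
  have h0 : x = 0 := by
    ext γ
    rcases h with h | h
    · exact h.elim γ
    · exact Subsingleton.elim _ _
  rw [mem_sphere_zero_iff_norm, h0, norm_zero] at hx
  exact absurd hx zero_ne_one

theorem l1Index_empty {Γ X : Type u} [Nonempty Γ] [NormedAddCommGroup X] [NormedSpace ℝ X]
    [Nontrivial X] : l1Index X (∅ : Set (EllOne Γ)) = ∞ := by
  obtain ⟨v, hv⟩ := exists_norm_eq X zero_le_one
  let y : EllInfty Γ X := ⟨fun _ => v, memℓp_infty ⟨1, by rintro _ ⟨γ, rfl⟩; exact hv.le⟩⟩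
  have hy : ‖y‖ = 1 := by
    rw [lp.norm_eq_ciSup]
    exact (ciSup_const (a := ‖v‖)).trans hv
  refine top_unique (le_sSup ⟨y, by rwa [mem_sphere_zero_iff_norm], by simp⟩)

theorem norm_ellOne_punit (a : EllOne PUnit.{u + 1}) : ‖a‖ = |a PUnit.unit| := by
  rw [norm_ellOne_eq_sum {PUnit.unit} a (by simp), Finset.sum_singleton]

theorem positiveSphere_punit_nonempty :
    {a ∈ Metric.sphere (0 : EllOne PUnit.{u + 1}) 1 | 0 < a PUnit.unit}.Nonempty := by
  obtain ⟨a, ha⟩ := exists_ellOne_eq {PUnit.unit.{u + 1}} (fun _ => 1) (by simp)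
  exact ⟨a, by rw [mem_sphere_zero_iff_norm, norm_ellOne_punit, ha, abs_one],
    by rw [ha]; exact one_pos⟩

/-- The class of trivial spaces is described by the positive half of the sphere of `l₁` of a
point. -/
theorem describesRegular_subsingleton {P : BanachClass.{u}}
    (hP : ∀ (X : Type u) [NormedAddCommGroup X] [NormedSpace ℝ X] [CompleteSpace X],
      P X ↔ Subsingleton X) :
    DescribesRegular P 1 {a ∈ Metric.sphere (0 : EllOne PUnit.{u + 1}) 1 | 0 < a PUnit.unit} := by
  set A := {a ∈ Metric.sphere (0 : EllOne PUnit.{u + 1}) 1 | 0 < a PUnit.unit}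
  have hlow : ∀ (X : Type u) [NormedAddCommGroup X] [NormedSpace ℝ X] [CompleteSpace X],
      ¬ P X → ENNReal.ofReal 1 ≤ l1Index X A := by
    intro X _ _ _ hX
    rw [hP, not_subsingleton_iff_nontrivial] at hX
    obtain ⟨v, hv⟩ := exists_norm_eq X zero_le_one
    refine ofReal_le_l1Index positiveSphere_punit_nonempty one_pos (fun _ => v) (fun _ => hv.le) fun a ha => ?_
    have h1 := ha.1
    rw [mem_sphere_zero_iff_norm, norm_ellOne_punit] at h1
    rw [tsum_eq_single PUnit.unit (by simp), norm_smul, Real.norm_eq_abs, h1, hv, one_mul]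
  have hup : ∀ (X : Type u) [NormedAddCommGroup X] [NormedSpace ℝ X] [CompleteSpace X],
      0 < l1Index X A → ¬ P X := by
    intro X _ _ _ hX hPX
    rw [l1Index_eq_zero_of_isEmpty A (Or.inr ((hP X).1 hPX))] at hX
    exact lt_irrefl _ hX
  have hpos : 0 < ENNReal.ofReal 1 := ENNReal.ofReal_pos.2 one_pos
  exact ⟨one_pos, fun a ha => ha.1, fun _ _ => Set.toFinite _,
    fun a₀ ha₀ a ha hs => ⟨ha, by
      have h1 := hs PUnit.unit
      rw [sign_pos ha₀.2] at h1
      exact sign_eq_one_iff.1 h1.symm⟩,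
    fun X _ _ _ => ⟨fun hX => hpos.trans_le (hlow X hX), hup X⟩,
    fun X _ _ _ => ⟨hlow X, fun hX => hup X (hpos.trans_le hX)⟩⟩

set_option maxSynthPendingDepth 6 in
-- Over an empty Γ the unit sphere is empty and every index is 0, so P and its coclass both contain
-- all spaces.
theorem DescribesRegular.coclass_of_isEmpty {P : BanachClass.{u}} {δ : ℝ} {Γ : Type u} [IsEmpty Γ]
    {A : Set (EllOne Γ)} (h : DescribesRegular P δ A) : DescribesRegular (coclass P) δ A := by
  have hP : ∀ (X : Type u) [NormedAddCommGroup X] [NormedSpace ℝ X] [CompleteSpace X], P X := by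
    intro X _ _ _
    by_contra hX
    have := (h.notMem_iff_index_pos X).1 hX
    rw [l1Index_eq_zero_of_isEmpty A (Or.inl inferInstance)] at this
    exact lt_irrefl _ this
  refine ⟨h.pos, h.subset_sphere, h.finite_support, h.sign_closed, fun X _ _ _ => ?_,
    fun X _ _ _ => ?_⟩
  · rw [← h.notMem_iff_index_pos X]
    exact iff_of_false (not_not.2 (hP (BidualQuotient X))) (not_not.2 (hP X))
  · rw [← h.notMem_iff_le_index X]
    exact iff_of_false (not_not.2 (hP (BidualQuotient X))) (not_not.2 (hP X))

theorem DescribesRegular.iff_subsingleton {P : BanachClass.{u}} {δ : ℝ} {Γ : Type u} [Nonempty Γ]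
    (h : DescribesRegular P δ (∅ : Set (EllOne Γ))) (X : Type u) [NormedAddCommGroup X]
    [NormedSpace ℝ X] [CompleteSpace X] : P X ↔ Subsingleton X := by
  rw [← not_iff_not, h.notMem_iff_index_pos X, not_subsingleton_iff_nontrivial]
  refine ⟨fun hX => ?_, fun _ => by simp [l1Index_empty]⟩
  by_contra hs
  rw [not_nontrivial_iff_subsingleton] at hs
  rw [l1Index_eq_zero_of_isEmpty _ (Or.inr hs)] at hX
  exact lt_irrefl _ hX

theorem theorem2 (P : BanachClass.{u}) (hP : IsRegularL1Property P) :
    IsRegularL1Property (coclass P) ∧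
      ∀ (δ : ℝ) (Γ : Type u) (A : Set (EllOne Γ)), A.Nonempty →
        DescribesRegular P δ A → DescribesRegular (coclass P) (δ / 3) (coFamily A) := by
  refine ⟨?_, fun δ Γ A hne h => h.coclass_coFamily hne⟩
  obtain ⟨δ, Γ, A, h⟩ := hP
  -- For empty A the family E is empty as well. If Γ is nonempty, P is then the class of trivial
  -- spaces and its coclass that of reflexive spaces, which E does not describe; P is first
  -- redescribed by a nonempty family over a point.
  rcases A.eq_empty_or_nonempty with rfl | hne
  · rcases isEmpty_or_nonempty Γ with hΓ | hΓ
    · exact ⟨_, _, _, h.coclass_of_isEmpty⟩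
    · exact ⟨_, _, _, (describesRegular_subsingleton h.iff_subsingleton).coclass_coFamily
        positiveSphere_punit_nonempty⟩
  · exact ⟨_, _, _, h.coclass_coFamily hne⟩
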